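/- Consider the uniform Leaky-ASM on $\mathbb Z^2$ with parameter $d>1$: sandpiles are functions $s:\mathbb Z^2\to\mathbb R$, a site may topple when it holds at least $4d$ chips, and when it topples it loses $4d$ chips, of which one is sent to each of its four nearest neighbours while the remaining $4(d-1)$ chips disappear. Let $D_{n,d}\subset\mathbb Z^2$ be the (finite) set of sites that topple while the configuration with $n$ chips at the origin and none elsewhere is stabilized; it does not depend on the order of the topplings. The boundary of $D_{n,d}$ is the set of sites of $D_{n,d}$ that have a nearest neighbour outside $D_{n,d}$. Let $d_n=1+t_n$ with $t_n>0$ for $n\ge 1$ and $t_n\to 0$ as $n\to\infty$. 1. If $t_n\to0$ slower than any power of $n$, i.e. $n^{-\varepsilon}=o(t_n)$ for every $\varepsilon>0$, then the boundary of $D_{n,d_n}$, scaled down by $\log(n)/\sqrt{t_n}$, converges in Hausdorff distance to the circle of radius $\frac12$ centred at the origin. 2. If $t_n\asymp n^{-(1-\alpha)}$ with $0<\alpha<1$ (in particular if $t_n\sim n^{-(1-\alpha)}$), then the region $D_{n,d_n}$, scaled down by $\log(n)/\sqrt{t_n}$, lies between two circles centred at the origin, the ratio of whose radii converges to $\alpha$: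 there are radii $\rho_n\to\frac{\alpha}{2}$ and $R_n\to\frac12$, so that $\rho_n/R_n\to\alpha$, such that for all sufficiently large $n$ every site $x\in\mathbb Z^2$ with $|x|\le\rho_n\log(n)/\sqrt{t_n}$ belongs to $D_{n,d_n}$, and every $x\in D_{n,d_n}$ satisfies $|x|\le R_n\log(n)/\sqrt{t_n}$, where $|\cdot|$ is the Euclidean norm. -/

import Mathlib

open Filter Topology Asymptotics

namespace LeakySandpile

/-- Sites of the square lattice. -/
abbrev Site := ℤ × ℤ

/-- A real-valued sandpile. -/
abbrev Config := Site → ℝ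

/-- The four nearest neighbours of a site. -/
def neighbors (x : Site) : Finset Site :=
  {(x.1 + 1, x.2), (x.1 - 1, x.2), (x.1, x.2 + 1), (x.1, x.2 - 1)}

/-- One topple of the uniform model at `x`: the site `x` loses `4 * d` chips and each of its four
neighbours receives one chip (the remaining `4 * (d - 1)` chips leak out of the system). -/
def topple (d : ℝ) (s : Config) (x : Site) : Config := fun y =>
  s y - (if y = x then 4 * d else 0) + (if y ∈ neighbors x then 1 else 0)

/-- `Topplings d s L f`: the sites of the list `L` can be toppled legally one after the other (each
of them holds at least `4 * d` chips when it topples), and this leads from `s` to `f`. -/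
inductive Topplings (d : ℝ) (s : Config) : List Site → Config → Prop
  | nil : Topplings d s [] s
  | snoc {L : List Site} {f : Config} {x : Site} :
      Topplings d s L f → 4 * d ≤ f x → Topplings d s (L ++ [x]) (topple d f x)

/-- A sandpile is stable if no site can topple. -/
def Stable (d : ℝ) (f : Config) : Prop := ∀ x, f x < 4 * d

/-- `n` chips at the origin. -/
def pointPile (n : ℕ) : Config := fun x => if x = 0 then (n : ℝ) else 0

/-- The set `D_{n,d}` of visited sites: the sites that topple while `n` chips at the origin are
stabilized. By `exists_stabilization` and `mem_iff_mem_visited` below, a stabilization exists for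
`d > 1`, and the set does not depend on the order of the topplings. -/
def visited (n : ℕ) (d : ℝ) : Set Site :=
  {x | ∃ L f, Topplings d (pointPile n) L f ∧ Stable d f ∧ x ∈ L}

/-- The boundary of a set of sites: its sites with a nearest neighbour outside the set. -/
def boundary (D : Set Site) : Set Site := {x ∈ D | ∃ y ∈ neighbors x, y ∉ D}

/-- The position of a site in the Euclidean plane after scaling down by `R`. -/
noncomputable def scaled (R : ℝ) (x : Site) : EuclideanSpace ℝ (Fin 2) :=
  R⁻¹ • !₂[(x.1 : ℝ), (x.2 : ℝ)]

/-! Well-definedness of the visited set. -/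

theorem topplings_apply {d : ℝ} {s f : Config} {L : List Site} (h : Topplings d s L f) (x : Site) :
    f x = s x - 4 * d * L.count x + ∑ y ∈ neighbors x, (L.count y : ℝ) := by
  induction h with
  | nil => simp
  | @snoc L f z h hz ih =>
    have hsymm : x ∈ neighbors z ↔ z ∈ neighbors x := by
      obtain ⟨a, b⟩ := x
      obtain ⟨a', b'⟩ := z
      simp only [neighbors, Finset.mem_insert, Finset.mem_singleton, Prod.mk.injEq]
      omega
    have e : ∀ y : Site, ((L ++ [z]).count y : ℝ) = L.count y + if y = z then 1 else 0 := by
      intro y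
      by_cases hy : y = z
      · simp [hy]
      · simp [hy, Ne.symm hy]
    simp only [topple, ih, e, Finset.sum_add_distrib, Finset.sum_ite_eq', hsymm]
    split_ifs <;> ring

theorem topplings_count_le {d : ℝ} {s f g : Config} {L M : List Site} (hL : Topplings d s L f)
    (hM : Topplings d s M g) (hg : Stable d g) (x : Site) : L.count x ≤ M.count x := by
  induction hL generalizing x with
  | nil => simp
  | @snoc L f z h hz ih =>
    by_cases hx : x = z
    · subst hx
      by_contra hlt
      have heq : L.count x = M.count x := by
        have := ih x
        simp at hlt
        omega
      have h1 := topplings_apply h x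
      have h2 := topplings_apply hM x
      have h3 : ∑ y ∈ neighbors x, (L.count y : ℝ) ≤ ∑ y ∈ neighbors x, (M.count y : ℝ) :=
        Finset.sum_le_sum fun y _ => by exact_mod_cast ih y
      have h4 := hg x
      rw [heq] at h1
      linarith
    · simpa [List.count_singleton, Ne.symm hx] using ih x

/-- Every stabilization of the pile visits exactly the sites of `visited n d`. -/
theorem mem_iff_mem_visited {n : ℕ} {d : ℝ} {L : List Site} {f : Config}
    (h : Topplings d (pointPile n) L f) (hf : Stable d f) (x : Site) :
    x ∈ L ↔ x ∈ visited n d := by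
  constructor
  · exact fun hx => ⟨L, f, h, hf, hx⟩
  · rintro ⟨M, g, hM, -, hx⟩
    have := topplings_count_le hM h hf x
    exact List.count_pos_iff.1 (lt_of_lt_of_le (List.count_pos_iff.2 hx) this)

theorem topplings_mass {n : ℕ} {d : ℝ} {L : List Site} {f : Config}
    (h : Topplings d (pointPile n) L f) :
    (∀ x, 0 ≤ f x) ∧ HasSum f ((n : ℝ) - 4 * (d - 1) * L.length) := by
  induction h with
  | nil =>
    refine ⟨fun x => ?_, ?_⟩
    · unfold pointPile
      split_ifs <;> positivity
    · have := hasSum_ite_eq (0 : Site) (n : ℝ)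
      simp only [List.length_nil, Nat.cast_zero, mul_zero, sub_zero]
      exact this
  | @snoc L f z h hz ih =>
    obtain ⟨h0, hs⟩ := ih
    refine ⟨fun y => ?_, ?_⟩
    · have := h0 y
      unfold topple
      by_cases hy : y = z
      · subst hy
        simp only [if_true]
        split_ifs <;> linarith
      · simp only [hy, if_false]
        split_ifs <;> linarith
    · have hc : (neighbors z).card = 4 := by
        obtain ⟨a, b⟩ := z
        simp only [neighbors]
        rw [Finset.card_insert_of_notMem, Finset.card_insert_of_notMem,
          Finset.card_insert_of_notMem, Finset.card_singleton] <;>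
          simp only [Finset.mem_insert, Finset.mem_singleton, Prod.mk.injEq] <;> omega
      have h1 : HasSum (fun y : Site => if y ∈ neighbors z then (1 : ℝ) else 0) 4 := by
        have := hasSum_sum_of_ne_finset_zero (L := .unconditional Site) (s := neighbors z)
          (f := fun y : Site => if y ∈ neighbors z then (1 : ℝ) else 0)
          (fun y hy => by simp [hy])
        simpa [hc] using this
      have h4 : HasSum (fun y : Site => if y = z then 4 * d else 0) (4 * d) := hasSum_ite_eq z (4 * d)
      have h2 := (hs.sub h4).add h1
      have h3 : (n : ℝ) - 4 * (d - 1) * (L ++ [z]).length =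
          (n : ℝ) - 4 * (d - 1) * L.length - 4 * d + 4 := by
        simp only [List.length_append, List.length_singleton, Nat.cast_add, Nat.cast_one]
        ring
      rw [h3]
      exact h2

/-- The pile stabilizes after finitely many topplings. -/
theorem exists_stabilization (n : ℕ) {d : ℝ} (hd : 1 < d) :
    ∃ L f, Topplings d (pointPile n) L f ∧ Stable d f := by
  by_contra hno
  have key : ∀ k : ℕ, ∃ L f, Topplings d (pointPile n) L f ∧ L.length = k := by
    intro k
    induction k with
    | zero => exact ⟨[], _, .nil, rfl⟩
    | succ k ih =>
      obtain ⟨L, f, h, hk⟩ := ih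
      have : ¬ Stable d f := fun hf => hno ⟨L, f, h, hf⟩
      simp only [Stable, not_forall, not_lt] at this
      obtain ⟨x, hx⟩ := this
      exact ⟨_, _, .snoc h hx, by simp [hk]⟩
  obtain ⟨k, hk⟩ := exists_nat_gt ((n : ℝ) / (4 * (d - 1)))
  obtain ⟨L, f, h, hL⟩ := key k
  obtain ⟨h0, hs⟩ := topplings_mass h
  have h1 := hs.nonneg h0
  have hpos : 0 < 4 * (d - 1) := by linarith
  rw [div_lt_iff₀ hpos] at hk
  rw [hL] at h1
  linarith

end LeakySandpile

namespace LeakySandpile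

/-! Write `d = 1 + t`. The toppling counts nearly solve `4 d u(x) = n δ₀(x) + ∑ u(neighbours)`,
whose solution is `n` times the Green function of a walk killed at rate about `t`. This decays like
`exp (-2 √t |x|)`, since `2 √t` is asymptotically the decay rate of the killed walk.

Outer bound: by least action, toppling counts lie below any supersolution. Plane waves give `count x
≤ V exp (-λ |x|)` with `λ ~ 2 √t` and `V` a bound for the count at the origin. Leaked mass only
gives `V = n / (4 t)`, which is too large when `t` is a power of `n`. It does confine the topplings
to a disc of polynomial radius, on which a logarithmic barrier improves `V` to `n · O(log n)`.
Counts are integers, so they vanish beyond about `log n / (2 √t)`.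

Inner bound: heights in the stable state are below `4 d`, so the counts plus the constant `d / t`
form a supersolution and dominate `n` times the Green function. A site where the latter exceeds `d /
t` must topple. At radius `σ log n / √t` this requires `n ^ (1 - 2 σ)` to beat `1 / t`: any `σ < 1 /
2` works if `t` decays slower than every power, and any `σ < α / 2` if `t ≍ n ^ (-(1 - α))`. The
constant `d / t` is the source of the gap between the two radii. -/

theorem sum_neighbors (F : Site → ℝ) (x : Site) :
    ∑ y ∈ neighbors x, F y =
      F (x.1 + 1, x.2) + F (x.1 - 1, x.2) + F (x.1, x.2 + 1) + F (x.1, x.2 - 1) := by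
  unfold neighbors
  rw [Finset.sum_insert, Finset.sum_insert, Finset.sum_insert, Finset.sum_singleton]
  · ring
  all_goals simp only [Finset.mem_insert, Finset.mem_singleton, Prod.mk.injEq]; omega

/-! ### Comparison with supersolutions -/

/-- Least action principle: a function that is a supersolution of the toppling equation wherever it
is not already known to dominate the toppling counts dominates them everywhere. -/
theorem topplings_count_le_of_super {d : ℝ} (hd : 0 < d) {s f : Config} {L : List Site}
    (hL : Topplings d s L f) {w : Site → ℝ} (hw : ∀ x, 0 ≤ w x)
    (h : ∀ x, (L.count x : ℝ) ≤ w x ∨ s x + ∑ y ∈ neighbors x, w y ≤ 4 * d * w x) (x : Site) :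
    (L.count x : ℝ) ≤ w x := by
  induction hL generalizing x with
  | nil => simpa using hw x
  | @snoc L f z hT hz ih =>
    -- Counts only grow along the list, so the first alternative passes to the shorter list.
    have ih' := ih fun y => (h y).imp_left fun hy => le_trans (by simp) hy
    by_cases hx : x = z
    · subst hx
      rcases h x with h1 | h1
      · exact h1
      · have h2 := topplings_apply hT x
        have h3 : ∑ y ∈ neighbors x, (L.count y : ℝ) ≤ ∑ y ∈ neighbors x, w y :=
          Finset.sum_le_sum fun y _ => ih' y
        -- Legality of this toppling, `4 * d ≤ f x`, provides the extra `+ 1`.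
        have h4 : 4 * d * ((L.count x : ℝ) + 1) ≤ 4 * d * w x := by linarith
        have h5 := le_of_mul_le_mul_left h4 (by positivity)
        simpa using h5
    · simpa [List.count_singleton, Ne.symm hx] using ih' x

/-- Euclidean distance of a site from the origin. -/
noncomputable def radius (x : Site) : ℝ := √((x.1 : ℝ) ^ 2 + (x.2 : ℝ) ^ 2)

theorem radius_sq (x : Site) : radius x ^ 2 = (x.1 : ℝ) ^ 2 + (x.2 : ℝ) ^ 2 :=
  Real.sq_sqrt (by positivity)

theorem radius_nonneg (x : Site) : 0 ≤ radius x := Real.sqrt_nonneg _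

theorem norm_scaled (R : ℝ) (x : Site) : ‖scaled R x‖ = |R|⁻¹ * radius x := by
  unfold scaled radius
  rw [norm_smul, EuclideanSpace.norm_eq]
  simp

theorem norm_scaled_sub_of_mem_neighbors {R : ℝ} {x y : Site} (h : y ∈ neighbors x) :
    ‖scaled R x - scaled R y‖ = |R|⁻¹ := by
  unfold scaled
  rw [← smul_sub, norm_smul, EuclideanSpace.norm_eq]
  simp only [neighbors, Finset.mem_insert, Finset.mem_singleton] at h
  rcases h with rfl | rfl | rfl | rfl <;> simp

theorem radius_le_of_mem_neighbors {x y : Site} (h : y ∈ neighbors x) :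
    radius y ≤ radius x + 1 := by
  have h1 := norm_scaled_sub_of_mem_neighbors (R := 1) h
  have h2 := norm_le_norm_add_norm_sub' (scaled 1 y) (scaled 1 x)
  rw [norm_sub_rev, h1, norm_scaled, norm_scaled] at h2
  simpa using h2

/-! ### Outer bound: exponential and logarithmic barriers -/

/-- The decay rate of the exponential supersolutions. -/
noncomputable def decayRate (t : ℝ) : ℝ := √(2 * Real.log (1 + 2 * t))

theorem decayRate_sq {t : ℝ} (ht : 0 < t) : decayRate t ^ 2 = 2 * Real.log (1 + 2 * t) :=
  Real.sq_sqrt (mul_nonneg zero_le_two (Real.log_nonneg (by linarith)))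

theorem decayRate_pos {t : ℝ} (ht : 0 < t) : 0 < decayRate t :=
  Real.sqrt_pos.2 (mul_pos zero_lt_two (Real.log_pos (by linarith)))

theorem exp_add_exp_neg_le (u : ℝ) : Real.exp u + Real.exp (-u) ≤ 2 * Real.exp (u ^ 2 / 2) := by
  have := Real.cosh_le_exp_half_sq u
  rw [Real.cosh_eq] at this
  linarith

/-- With `A`, `B` the Gaussian bounds for the two hyperbolic cosines, the decay rate is chosen so
that `A B = 1 + 2 t` in every direction. Then `(A - 1) (B - 1) ≥ 0` yields `A + B ≤ 2 (1 + t)`. -/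
theorem sum_neighbors_exp_le {t : ℝ} (ht : 0 < t) {e₁ e₂ : ℝ} (he : e₁ ^ 2 + e₂ ^ 2 = 1)
    (x : Site) :
    ∑ y ∈ neighbors x, Real.exp (-(decayRate t * (e₁ * y.1 + e₂ * y.2))) ≤
      4 * (1 + t) * Real.exp (-(decayRate t * (e₁ * x.1 + e₂ * x.2))) := by
  rw [sum_neighbors]
  set l := decayRate t
  push_cast
  set E := Real.exp (-(l * (e₁ * x.1 + e₂ * x.2)))
  have h1 : Real.exp (-(l * (e₁ * (x.1 + 1) + e₂ * x.2))) = E * Real.exp (-(l * e₁)) := by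
    rw [← Real.exp_add]; congr 1; ring
  have h2 : Real.exp (-(l * (e₁ * (x.1 - 1) + e₂ * x.2))) = E * Real.exp (l * e₁) := by
    rw [← Real.exp_add]; congr 1; ring
  have h3 : Real.exp (-(l * (e₁ * x.1 + e₂ * (x.2 + 1)))) = E * Real.exp (-(l * e₂)) := by
    rw [← Real.exp_add]; congr 1; ring
  have h4 : Real.exp (-(l * (e₁ * x.1 + e₂ * (x.2 - 1)))) = E * Real.exp (l * e₂) := by
    rw [← Real.exp_add]; congr 1; ring
  rw [h1, h2, h3, h4]
  have hE : 0 < E := Real.exp_pos _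
  have k1 := exp_add_exp_neg_le (l * e₁)
  have k2 := exp_add_exp_neg_le (l * e₂)
  have a1 : 1 ≤ Real.exp ((l * e₁) ^ 2 / 2) := Real.one_le_exp (by positivity)
  have a2 : 1 ≤ Real.exp ((l * e₂) ^ 2 / 2) := Real.one_le_exp (by positivity)
  have a3 : Real.exp ((l * e₁) ^ 2 / 2) * Real.exp ((l * e₂) ^ 2 / 2) = 1 + 2 * t := by
    rw [← Real.exp_add]
    have : (l * e₁) ^ 2 / 2 + (l * e₂) ^ 2 / 2 = Real.log (1 + 2 * t) := by
      have := decayRate_sq ht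
      linear_combination (l ^ 2 / 2) * he + this / 2
    rw [this, Real.exp_log (by linarith)]
  have a4 := mul_nonneg (sub_nonneg.2 a1) (sub_nonneg.2 a2)
  have a5 : Real.exp (-(l * e₁)) + Real.exp (l * e₁) + Real.exp (-(l * e₂)) + Real.exp (l * e₂)
      ≤ 4 * (1 + t) := by nlinarith
  nlinarith

/-- Exponential decay of the toppling counts away from the origin. -/
theorem topplings_count_le_exp {n : ℕ} {t : ℝ} (ht : 0 < t) {L : List Site} {f : Config}
    (h : Topplings (1 + t) (pointPile n) L f) {V : ℝ} (hV : (L.count 0 : ℝ) ≤ V) (x : Site) :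
    (L.count x : ℝ) ≤ V * Real.exp (-(decayRate t * radius x)) := by
  have hV0 : 0 ≤ V := le_trans (Nat.cast_nonneg _) hV
  -- The plane wave is taken in the direction of `x`, where it is smallest; at the origin any
  -- direction serves.
  obtain ⟨e₁, e₂, he, hx⟩ : ∃ e₁ e₂ : ℝ, e₁ ^ 2 + e₂ ^ 2 = 1 ∧ e₁ * x.1 + e₂ * x.2 = radius x := by
    by_cases hr : radius x = 0
    · have h0 := radius_sq x
      rw [hr] at h0
      have hx1 : (x.1 : ℝ) = 0 := by nlinarith
      have hx2 : (x.2 : ℝ) = 0 := by nlinarith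
      exact ⟨1, 0, by norm_num, by rw [hr, hx1, hx2]; ring⟩
    · refine ⟨x.1 / radius x, x.2 / radius x, ?_, ?_⟩
      · field_simp
        exact (radius_sq x).symm
      · field_simp
        exact (radius_sq x).symm
  rw [← hx]
  refine topplings_count_le_of_super (d := 1 + t) (by linarith) h
    (w := fun y => V * Real.exp (-(decayRate t * (e₁ * y.1 + e₂ * y.2))))
    (fun y => by positivity) (fun y => ?_) x
  -- The plane wave need not absorb the source at the origin: there the count is bounded by `V`
  -- outright.
  by_cases hy : y = 0
  · left
    subst hy
    simpa using hV
  · right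
    simp only [pointPile, hy, if_false, zero_add]
    rw [← Finset.mul_sum]
    have := mul_le_mul_of_nonneg_left (sum_neighbors_exp_le ht he y) hV0
    linarith

/-- Each toppling leaks `4 t` of the `n` chips. This crude bound only starts the bootstrap. -/
theorem topplings_count_zero_le {n : ℕ} {t : ℝ} (ht : 0 < t) {L : List Site} {f : Config}
    (h : Topplings (1 + t) (pointPile n) L f) : (L.count 0 : ℝ) ≤ n / (4 * t) := by
  obtain ⟨h0, hs⟩ := topplings_mass h
  have h1 := hs.nonneg h0
  have h2 : (L.count 0 : ℝ) ≤ L.length := by exact_mod_cast List.count_le_length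
  rw [le_div_iff₀ (by positivity)]
  nlinarith

/-- A positive count is at least 1, so the exponential bound cannot have dropped below 1. -/
theorem radius_le_of_count_pos {t V : ℝ} (ht : 0 < t) {k : ℕ} (hk : 0 < k) {x : Site}
    (h : (k : ℝ) ≤ V * Real.exp (-(decayRate t * radius x))) :
    radius x ≤ Real.log V / decayRate t := by
  have h1 : (1 : ℝ) ≤ k := by exact_mod_cast hk
  have hE := Real.exp_pos (-(decayRate t * radius x))
  have hV : 0 < V := by
    by_contra hV
    nlinarith
  have h2 := Real.log_le_log one_pos (h1.trans h)
  rw [Real.log_one, Real.log_mul hV.ne' hE.ne', Real.log_exp] at h2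
  rw [le_div_iff₀ (decayRate_pos ht)]
  linarith

/-- Discrete subharmonicity of `log (1 + |x|²)`. -/
theorem four_mul_log_le (x : Site) :
    4 * Real.log (1 + radius x ^ 2) + (if x = 0 then 1 else 0) ≤
      ∑ y ∈ neighbors x, Real.log (1 + radius y ^ 2) := by
  rw [sum_neighbors]
  simp only [radius_sq]
  split_ifs with hx
  · subst hx
    have := Real.log_two_gt_d9
    norm_num
    linarith
  · have h (a b : ℝ) : 0 < 1 + (a ^ 2 + b ^ 2) := by positivity
    rw [add_zero, ← Real.log_mul (h _ _).ne' (h _ _).ne',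
      ← Real.log_mul (mul_pos (h _ _) (h _ _)).ne' (h _ _).ne',
      ← Real.log_mul (mul_pos (mul_pos (h _ _) (h _ _)) (h _ _)).ne' (h _ _).ne']
    rw [show (4 : ℝ) = ((4 : ℕ) : ℝ) by norm_num, ← Real.log_pow]
    apply Real.log_le_log (pow_pos (h _ _) 4)
    push_cast
    generalize (x.1 : ℝ) = a
    generalize (x.2 : ℝ) = b
    -- After exponentiation the claim is polynomial, and the difference is a sum of visibly
    -- nonnegative terms.
    have key : (1 + ((a + 1) ^ 2 + b ^ 2)) * (1 + ((a - 1) ^ 2 + b ^ 2)) *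
        (1 + (a ^ 2 + (b + 1) ^ 2)) * (1 + (a ^ 2 + (b - 1) ^ 2)) - (1 + (a ^ 2 + b ^ 2)) ^ 4 =
        2 * (2 + (a ^ 2 + b ^ 2)) ^ 2 + 4 * (a ^ 2 + b ^ 2) + 7 + 16 * a ^ 2 * b ^ 2 := by ring
    have : 0 ≤ 2 * (2 + (a ^ 2 + b ^ 2)) ^ 2 + 4 * (a ^ 2 + b ^ 2) + 7 + 16 * a ^ 2 * b ^ 2 := by
      positivity
    linarith

/-- The barrier is `n (M - log (1 + |x|²))` truncated at 0. It is superharmonic and its defect at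
the origin absorbs the `n` chips. The truncation is inactive at neighbours of the disc of radius
`R`, and outside that disc the counts vanish. -/
theorem topplings_count_zero_le_log {n : ℕ} {t R : ℝ} (ht : 0 < t) {L : List Site}
    {f : Config} (h : Topplings (1 + t) (pointPile n) L f)
    (hL : ∀ x, 0 < L.count x → radius x ≤ R) :
    (L.count 0 : ℝ) ≤ n * Real.log (1 + (R + 1) ^ 2) := by
  set M := Real.log (1 + (R + 1) ^ 2)
  have hmono {x : Site} (hx : radius x ≤ R + 1) : Real.log (1 + radius x ^ 2) ≤ M := by
    apply Real.log_le_log (by positivity)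
    have := radius_nonneg x
    gcongr
  have key := topplings_count_le_of_super (d := 1 + t) (by linarith) h
    (w := fun y => n * max (M - Real.log (1 + radius y ^ 2)) 0) (fun y => by positivity)
    (fun y => ?_) 0
  · have h0 : radius 0 = 0 := by simp [radius]
    have hM : 0 ≤ M := Real.log_nonneg (by nlinarith [sq_nonneg (R + 1)])
    simpa [h0, hM] using key
  · by_cases hy : radius y ≤ R
    · right
      have h1 : ∀ z ∈ neighbors y, (n : ℝ) * max (M - Real.log (1 + radius z ^ 2)) 0 =
          n * (M - Real.log (1 + radius z ^ 2)) := fun z hz => by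
        rw [max_eq_left]
        have := hmono ((radius_le_of_mem_neighbors hz).trans (by linarith : _ ≤ R + 1))
        linarith
      have h2 := hmono (by linarith : radius y ≤ R + 1)
      rw [Finset.sum_congr rfl h1, max_eq_left (by linarith), ← Finset.mul_sum]
      have h3 := four_mul_log_le y
      have h4 : ∑ z ∈ neighbors y, (M - Real.log (1 + radius z ^ 2)) =
          4 * M - ∑ z ∈ neighbors y, Real.log (1 + radius z ^ 2) := by
        simp only [sum_neighbors]
        ring
      have h5 : pointPile n y = n * (if y = 0 then 1 else 0) := by
        unfold pointPile
        split_ifs <;> simp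
      rw [h4, h5]
      have hn : (0 : ℝ) ≤ n := Nat.cast_nonneg n
      have h6 := mul_nonneg hn (sub_nonneg.2 h3)
      have h7 : 0 ≤ t * (n * (M - Real.log (1 + radius y ^ 2))) := by
        have : 0 ≤ M - Real.log (1 + radius y ^ 2) := by linarith
        positivity
      linarith
    · left
      have : L.count y = 0 := by
        by_contra hc
        exact hy (hL y (Nat.pos_of_ne_zero hc))
      rw [this]
      simp only [Nat.cast_zero]
      positivity

/-- Outer bound for the visited set. -/
theorem radius_le_of_mem_visited {n : ℕ} {t R : ℝ} (ht : 0 < t)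
    (hR : Real.log (n / (4 * t)) / decayRate t ≤ R) {x : Site} (hx : x ∈ visited n (1 + t)) :
    radius x ≤ Real.log (n * Real.log (1 + (R + 1) ^ 2)) / decayRate t := by
  obtain ⟨L, f, h, -, hxL⟩ := hx
  -- Bootstrap: the crude bound confines the topplings to radius `R`, which makes the logarithmic
  -- bound at the origin available for a second exponential estimate.
  have h1 := topplings_count_le_exp ht h (topplings_count_zero_le ht h)
  have h2 := topplings_count_le_exp ht h (topplings_count_zero_le_log ht h fun y hy =>
    (radius_le_of_count_pos ht hy (h1 y)).trans hR)
  exact radius_le_of_count_pos ht (List.count_pos_iff.2 hxL) (h2 x)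

/-! ### Path counts and the leaky Green function -/

/-- Number of `k`-step paths of the simple random walk on `ℤ` from `0` to `m`. -/
noncomputable def pathCount : ℕ → ℤ → ℝ
  | 0, m => if m = 0 then 1 else 0
  | k + 1, m => pathCount k (m - 1) + pathCount k (m + 1)

theorem pathCount_nonneg (k : ℕ) (m : ℤ) : 0 ≤ pathCount k m := by
  induction k generalizing m with
  | zero => unfold pathCount; split_ifs <;> norm_num
  | succ k ih => exact add_nonneg (ih _) (ih _)

theorem choose_le_pathCount (k i : ℕ) : (k.choose i : ℝ) ≤ pathCount k (2 * i - k) := by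
  induction k generalizing i with
  | zero =>
    rcases i with _ | i
    · simp [pathCount]
    · simpa using pathCount_nonneg 0 _
  | succ k ih =>
    rw [pathCount]
    rcases i with _ | i
    · have h1 := ih 0
      have h2 := pathCount_nonneg k (2 * ((0 : ℕ) : ℤ) - ((k + 1 : ℕ) : ℤ) - 1)
      have e : (2 * ((0 : ℕ) : ℤ) - ((k + 1 : ℕ) : ℤ) + 1) = 2 * ((0 : ℕ) : ℤ) - k := by
        push_cast; ring
      rw [e]
      simp only [Nat.choose_zero_right] at h1 ⊢
      linarith
    · have h1 := ih i
      have h2 := ih (i + 1)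
      have e1 : (2 * ((i + 1 : ℕ) : ℤ) - ((k + 1 : ℕ) : ℤ) - 1) = 2 * (i : ℤ) - k := by
        push_cast; ring
      have e2 : (2 * ((i + 1 : ℕ) : ℤ) - ((k + 1 : ℕ) : ℤ) + 1) = 2 * ((i + 1 : ℕ) : ℤ) - k := by
        push_cast; ring
      rw [e1, e2, Nat.choose_succ_succ]
      push_cast at *
      linarith

/-- A nonnegative supersolution dominates the partial sums of the Green function series. -/
theorem sum_pathCount_le {n : ℕ} {d : ℝ} (hd : 0 < d) {u : Site → ℝ} (hu : ∀ x, 0 ≤ u x)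
    (h : ∀ x, pointPile n x + ∑ y ∈ neighbors x, u y ≤ 4 * d * u x) (K : ℕ) (x : Site) :
    n * ∑ k ∈ Finset.range K,
      pathCount k (x.1 + x.2) * pathCount k (x.1 - x.2) / (4 * d) ^ (k + 1) ≤ u x := by
  induction K generalizing x with
  | zero => simpa using hu x
  | succ K ih =>
    have hs : ∑ y ∈ neighbors x, (n * ∑ k ∈ Finset.range K,
        pathCount k (y.1 + y.2) * pathCount k (y.1 - y.2) / (4 * d) ^ (k + 1)) ≤
        ∑ y ∈ neighbors x, u y := Finset.sum_le_sum fun y _ => ih y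
    rw [← Finset.mul_sum, Finset.sum_comm] at hs
    -- In the coordinates `x.1 + x.2` and `x.1 - x.2` a planar step is a pair of independent `±1`
    -- steps, so planar path counts are products. Summing the `k`-th term over neighbours gives `4
    -- d` times the next term.
    have e : ∀ k, ∑ y ∈ neighbors x,
        pathCount k (y.1 + y.2) * pathCount k (y.1 - y.2) / (4 * d) ^ (k + 1) =
        4 * d * (pathCount (k + 1) (x.1 + x.2) * pathCount (k + 1) (x.1 - x.2) /
          (4 * d) ^ (k + 1 + 1)) := fun k => by
      rw [← Finset.sum_div, sum_neighbors]
      simp only [pathCount]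
      rw [show x.1 + 1 + x.2 = x.1 + x.2 + 1 by ring, show x.1 + 1 - x.2 = x.1 - x.2 + 1 by ring,
        show x.1 - 1 + x.2 = x.1 + x.2 - 1 by ring, show x.1 - 1 - x.2 = x.1 - x.2 - 1 by ring,
        show x.1 + (x.2 + 1) = x.1 + x.2 + 1 by ring, show x.1 - (x.2 + 1) = x.1 - x.2 - 1 by ring,
        show x.1 + (x.2 - 1) = x.1 + x.2 - 1 by ring, show x.1 - (x.2 - 1) = x.1 - x.2 + 1 by ring]
      field_simp
      ring
    simp only [e] at hs
    rw [← Finset.mul_sum] at hs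
    rw [Finset.sum_range_succ']
    have h0 : pathCount 0 (x.1 + x.2) * pathCount 0 (x.1 - x.2) / (4 * d) ^ (0 + 1) * n =
        pointPile n x / (4 * d) := by
      simp only [pathCount, pointPile, zero_add, pow_one]
      by_cases hx : x = 0
      · subst hx; simp; ring
      · have : ¬ (x.1 + x.2 = 0 ∧ x.1 - x.2 = 0) := fun hh => hx (by
          ext
          · change x.1 = 0; omega
          · change x.2 = 0; omega)
        rw [if_neg hx]
        split_ifs <;> simp_all
    have h1 := h x
    rw [← mul_le_mul_iff_right₀ (show 0 < 4 * d by positivity)]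
    have h2 : 4 * d * (pathCount 0 (x.1 + x.2) * pathCount 0 (x.1 - x.2) / (4 * d) ^ (0 + 1) * n)
        = pointPile n x := by
      rw [h0]; field_simp
    linarith

theorem four_pow_le_centralBinom {j : ℕ} (hj : 0 < j) :
    (4 : ℝ) ^ j ≤ 2 * √j * j.centralBinom := by
  induction j, hj using Nat.le_induction with
  | base => norm_num [Nat.centralBinom]
  | succ j hj ih =>
    have h1 : ((j : ℝ) + 1) * (j + 1).centralBinom = 2 * (2 * j + 1) * j.centralBinom := by
      exact_mod_cast Nat.succ_mul_centralBinom_succ j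
    push_cast
    have hj0 : (0 : ℝ) < j := by exact_mod_cast hj
    set a := √(j : ℝ)
    set b := √((j : ℝ) + 1)
    have ha : a ^ 2 = j := Real.sq_sqrt hj0.le
    have hb : b ^ 2 = j + 1 := Real.sq_sqrt (by positivity)
    have hb0 : 0 < b := Real.sqrt_pos.2 (by positivity)
    have hC : (0 : ℝ) ≤ j.centralBinom := Nat.cast_nonneg _
    -- AM-GM for `√j` and `√(j + 1)`.
    have h2 : 2 * (a * b) ≤ 2 * j + 1 := by nlinarith [sq_nonneg (a - b)]
    have h3 : (4 : ℝ) ^ (j + 1) * b ≤ (2 * b * (j + 1).centralBinom) * b := by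
      calc (4 : ℝ) ^ (j + 1) * b = 4 * b * 4 ^ j := by ring
        _ ≤ 4 * b * (2 * a * j.centralBinom) := by gcongr
        _ = 4 * (2 * (a * b)) * j.centralBinom := by ring
        _ ≤ 4 * (2 * j + 1) * j.centralBinom := by gcongr
        _ = 2 * (((j : ℝ) + 1) * (j + 1).centralBinom) := by rw [h1]; ring
        _ = _ := by rw [← hb]; ring
    exact le_of_mul_le_mul_right h3 hb0

/-- Consecutive coefficients have ratio `(j - p) / (j + p + 1) = 1 / (1 + a)` with `a = (2 p + 1) /
(j - p)`, and `1 + a ≤ exp a`. The odd numbers `2 p + 1` add up to a square; `r` makes the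
denominator uniform. -/
theorem centralBinom_mul_exp_le_choose {j r : ℕ} (hr : r < j) {p : ℕ} (hp : p ≤ r) :
    (j.centralBinom : ℝ) * Real.exp (-((p : ℝ) ^ 2 / (j - r))) ≤ (2 * j).choose (j + p) := by
  have hjr : (0 : ℝ) < j - r := sub_pos.2 (by exact_mod_cast hr)
  induction p with
  | zero => simp [Nat.centralBinom]
  | succ p ih =>
    have ih := ih (by omega)
    have h1 : ((2 * j).choose (j + (p + 1)) : ℝ) * (j + p + 1) =
        (2 * j).choose (j + p) * (j - p) := by
      have := Nat.choose_succ_right_eq (2 * j) (j + p)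
      rw [show 2 * j - (j + p) = j - p by omega] at this
      have h2 : (((2 * j).choose (j + p + 1) * (j + p + 1) : ℕ) : ℝ) =
        (((2 * j).choose (j + p) * (j - p) : ℕ) : ℝ) := by rw [this]
      push_cast [Nat.cast_sub (show p ≤ j by omega)] at h2
      exact h2
    have hpr : (p : ℝ) + 1 ≤ r := by exact_mod_cast hp
    have hjp : (0 : ℝ) < j - p := by linarith
    have hexp : Real.exp (-((2 * p + 1) / ((j : ℝ) - r))) * (j + p + 1) ≤ j - p := by
      rw [Real.exp_neg, inv_mul_le_iff₀ (Real.exp_pos _)]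
      have h3 := Real.add_one_le_exp ((2 * p + 1) / ((j : ℝ) - r))
      have h4 : (2 * p + 1) / ((j : ℝ) - p) ≤ (2 * p + 1) / ((j : ℝ) - r) := by
        gcongr
        linarith
      calc (j : ℝ) + p + 1 = ((2 * p + 1) / ((j : ℝ) - p) + 1) * (j - p) := by field_simp; ring
        _ ≤ _ := by gcongr; linarith
    have hjp1 : (0 : ℝ) < j + p + 1 := by positivity
    refine le_of_mul_le_mul_right ?_ hjp1
    rw [h1]
    push_cast
    calc _ = (j.centralBinom * Real.exp (-((p : ℝ) ^ 2 / (j - r)))) *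
        (Real.exp (-((2 * p + 1) / ((j : ℝ) - r))) * (j + p + 1)) := by
          rw [show -(((p : ℝ) + 1) ^ 2 / (j - r)) =
            -((p : ℝ) ^ 2 / (j - r)) + -((2 * p + 1) / ((j : ℝ) - r)) by ring, Real.exp_add]
          ring
      _ ≤ _ := by gcongr

theorem pathCount_neg (k : ℕ) (m : ℤ) : pathCount k (-m) = pathCount k m := by
  induction k generalizing m with
  | zero => simp [pathCount]
  | succ k ih =>
    rw [pathCount, pathCount, add_comm, ← ih (m - 1), ← ih (m + 1)]
    congr 2 <;> ring

theorem le_pathCount {j : ℕ} {p : ℤ} {S : ℝ} (hp : |(p : ℝ)| ≤ S) (hS : S < j) :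
    4 ^ j / (2 * √j) * Real.exp (-((p : ℝ) ^ 2 / (j - S))) ≤ pathCount (2 * j) (2 * p) := by
  have hS0 : 0 ≤ S := (abs_nonneg _).trans hp
  have hj : 0 < j := by exact_mod_cast hS0.trans_lt hS
  have hpS : ((p.natAbs : ℕ) : ℝ) ≤ S := by rwa [Nat.cast_natAbs, Int.cast_abs]
  have hpj : p.natAbs < j := by exact_mod_cast hpS.trans_lt hS
  have h1 := centralBinom_mul_exp_le_choose hpj le_rfl
  have h2 := choose_le_pathCount (2 * j) (j + p.natAbs)
  have e : (2 * ((j + p.natAbs : ℕ) : ℤ) - ((2 * j : ℕ) : ℤ)) = 2 * |p| := by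
    push_cast
    ring
  have h3 : pathCount (2 * j) (2 * |p|) = pathCount (2 * j) (2 * p) := by
    rcases abs_choice p with h | h
    · rw [h]
    · rw [h, mul_neg, pathCount_neg]
  rw [e, h3] at h2
  refine le_trans ?_ (h1.trans h2)
  have hjr : (0 : ℝ) < √j := Real.sqrt_pos.2 (by exact_mod_cast hj)
  have h5 : ((p.natAbs : ℕ) : ℝ) ^ 2 = (p : ℝ) ^ 2 := by
    rw [Nat.cast_natAbs, Int.cast_abs, sq_abs]
  rw [h5]
  gcongr
  · rw [div_le_iff₀ (by positivity)]
    linarith [four_pow_le_centralBinom hj]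

/-! ### Inner bound -/

/-- Inner bound for the visited set. -/
theorem mem_visited_of_radius_le {n : ℕ} {t S : ℝ} (ht : 0 < t) {J W : ℕ} (hSJ : S < J)
    (hn : (1 + t) / t < n / (4 * (1 + t)) * (W / (16 * (1 + t) * (J + W)) *
      Real.exp (-(2 * t * (J + W) + S ^ 2 / (2 * (J - S))))))
    {x : Site} (hx : radius x + 1 ≤ S) : x ∈ visited n (1 + t) := by
  obtain ⟨L, f, hL, hf⟩ := exists_stabilization n (d := 1 + t) (by linarith)
  rw [← mem_iff_mem_visited hL hf, ← List.count_pos_iff]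
  by_contra hx0
  have hx0 : L.count x = 0 := by omega
  have hJ : (0 : ℝ) < J := by linarith [radius_nonneg x]
  -- A constant `c` adds `4 t c` to the slack of the equation; this `c` makes that `4 (1 + t)`, the
  -- bound on stable heights.
  set u : Site → ℝ := fun y => L.count y + (1 + t) / t with hu
  have hu0 : ∀ y, 0 ≤ u y := fun y => by positivity
  have husuper : ∀ y, pointPile n y + ∑ z ∈ neighbors y, u z ≤ 4 * (1 + t) * u y := fun y => by
    have h1 := topplings_apply hL y
    have h2 := hf y
    rw [sum_neighbors] at h1 ⊢
    simp only [hu]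
    have h3 : t * ((1 + t) / t) = 1 + t := by field_simp
    linarith
  have hux : u x = (1 + t) / t := by simp [hu, hx0]
  -- Only even times are used, so `y` must be an even site. If `x` is odd, a neighbour is taken at
  -- the cost of a factor `4 (1 + t)` and of 1 in the radius.
  obtain ⟨y, hyx, p, q, hy1, hy2, hy⟩ : ∃ y : Site, u y ≤ 4 * (1 + t) * u x ∧
      ∃ p q : ℤ, y.1 + y.2 = 2 * p ∧ y.1 - y.2 = 2 * q ∧ radius y ≤ S := by
    rcases Int.even_or_odd' (x.1 + x.2) with ⟨p, hp | hp⟩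
    · refine ⟨x, ?_, p, x.1 - p, hp, by omega, by linarith⟩
      nlinarith [hu0 x]
    · have hmem : (x.1 + 1, x.2) ∈ neighbors x := by simp [neighbors]
      refine ⟨(x.1 + 1, x.2), ?_, p + 1, x.1 - p, ?_, ?_,
        (radius_le_of_mem_neighbors hmem).trans hx⟩
      · have h1 := husuper x
        have h2 := Finset.single_le_sum (fun z _ => hu0 z) hmem
        have h3 : 0 ≤ pointPile n x := by unfold pointPile; split_ifs <;> positivity
        linarith
      · change x.1 + 1 + x.2 = _; omega
      · change x.1 + 1 - x.2 = _; omega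
  have hsum := sum_pathCount_le (n := n) (d := 1 + t) (by linarith) hu0 husuper
    (2 * (J + W)) y
  have hpq : 2 * ((p : ℝ) ^ 2 + q ^ 2) ≤ S ^ 2 := by
    have h1 := radius_sq y
    have h2 : (y.1 : ℝ) + y.2 = 2 * p := by exact_mod_cast hy1
    have h3 : (y.1 : ℝ) - y.2 = 2 * q := by exact_mod_cast hy2
    have h4 := pow_le_pow_left₀ (radius_nonneg y) hy 2
    have h5 : (y.1 : ℝ) = p + q := by linarith
    have h6 : (y.2 : ℝ) = p - q := by linarith
    rw [h1, h5, h6] at h4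
    linarith
  have hS0 : 0 ≤ S := (radius_nonneg y).trans hy
  have hp : |(p : ℝ)| ≤ S := abs_le_of_sq_le_sq (by nlinarith) hS0
  have hq : |(q : ℝ)| ≤ S := abs_le_of_sq_le_sq (by nlinarith) hS0
  have hterm : ∀ j ∈ Finset.Ico J (J + W), 1 / (16 * (1 + t) * (J + W)) *
      Real.exp (-(2 * t * (J + W) + S ^ 2 / (2 * (J - S)))) ≤
      pathCount (2 * j) (y.1 + y.2) * pathCount (2 * j) (y.1 - y.2) /
        (4 * (1 + t)) ^ (2 * j + 1) := fun j hj => by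
    rw [Finset.mem_Ico] at hj
    have hj1 : (J : ℝ) ≤ j := by exact_mod_cast hj.1
    have hj2 : (j : ℝ) ≤ J + W := by exact_mod_cast hj.2.le
    have hj0 : (0 : ℝ) < j := by linarith
    have hSj : S < j := by linarith
    rw [hy1, hy2]
    have k1 := le_pathCount hp hSj
    have k2 := le_pathCount hq hSj
    have k3 : (1 + t) ^ (2 * j) ≤ Real.exp (2 * t * (J + W)) := by
      calc (1 + t) ^ (2 * j) ≤ Real.exp t ^ (2 * j) := by
            gcongr
            linarith [Real.add_one_le_exp t]
        _ = Real.exp (2 * t * j) := by rw [← Real.exp_nat_mul]; congr 1; push_cast; ring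
        _ ≤ _ := by gcongr
    have k4 : (p : ℝ) ^ 2 / (j - S) + (q : ℝ) ^ 2 / (j - S) ≤ S ^ 2 / (2 * (J - S)) := by
      have hJS : 0 < J - S := by linarith
      rw [← add_div, ← div_div]
      gcongr
      linarith
    calc _ = 1 / (16 * (1 + t) * (J + W)) * (Real.exp (2 * t * (J + W)))⁻¹ *
            Real.exp (-(S ^ 2 / (2 * (J - S)))) := by
          rw [neg_add, Real.exp_add, Real.exp_neg (2 * t * (J + W)), ← mul_assoc]
      _ ≤ 1 / (16 * (1 + t) * j) * ((1 + t) ^ (2 * j))⁻¹ *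
            Real.exp (-((p : ℝ) ^ 2 / (j - S) + (q : ℝ) ^ 2 / (j - S))) := by
          gcongr
      _ = (4 ^ j / (2 * √j) * Real.exp (-((p : ℝ) ^ 2 / (j - S)))) *
          (4 ^ j / (2 * √j) * Real.exp (-((q : ℝ) ^ 2 / (j - S)))) /
            (4 * (1 + t)) ^ (2 * j + 1) := by
          rw [neg_add, Real.exp_add, mul_pow, pow_succ 4 (2 * j), pow_succ (1 + t) (2 * j),
            two_mul j, pow_add 4 j j]
          have : √(j : ℝ) ^ 2 = j := Real.sq_sqrt hj0.le
          have hsj : 0 < √(j : ℝ) := Real.sqrt_pos.2 hj0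
          have h4 : (0 : ℝ) < 4 ^ j := by positivity
          field_simp
          rw [this]
          ring
      _ ≤ _ := by
          gcongr
          exact pathCount_nonneg _ _
  have hle : W / (16 * (1 + t) * (J + W)) *
      Real.exp (-(2 * t * (J + W) + S ^ 2 / (2 * (J - S)))) ≤
      ∑ k ∈ Finset.range (2 * (J + W)),
        pathCount k (y.1 + y.2) * pathCount k (y.1 - y.2) / (4 * (1 + t)) ^ (k + 1) := by
    -- Only the even times `2 j` with `j` in a window of length `W` are kept; all of them obey the
    -- same lower bound.
    have h1 := Finset.card_nsmul_le_sum _ _ _ hterm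
    rw [Nat.card_Ico, nsmul_eq_mul, Nat.add_sub_cancel_left] at h1
    calc _ = (W : ℝ) * (1 / (16 * (1 + t) * (J + W)) *
          Real.exp (-(2 * t * (J + W) + S ^ 2 / (2 * (J - S))))) := by ring
      _ ≤ _ := h1
      _ = ∑ k ∈ (Finset.Ico J (J + W)).image (2 * ·),
        pathCount k (y.1 + y.2) * pathCount k (y.1 - y.2) / (4 * (1 + t)) ^ (k + 1) := by
          rw [Finset.sum_image fun a _ b _ hab => by simpa using hab]
      _ ≤ _ := by
          refine Finset.sum_le_sum_of_subset_of_nonneg ?_ fun k _ _ => ?_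
          · intro k hk
            simp only [Finset.mem_image, Finset.mem_Ico, Finset.mem_range] at hk ⊢
            omega
          · have h1 := pathCount_nonneg k (y.1 + y.2)
            have h2 := pathCount_nonneg k (y.1 - y.2)
            positivity
  have h1 := mul_le_mul_of_nonneg_left hle (Nat.cast_nonneg (α := ℝ) n)
  have h2 := (h1.trans hsum).trans hyx
  rw [hux] at h2
  have h3 : n / (4 * (1 + t)) * (W / (16 * (1 + t) * (J + W)) *
      Real.exp (-(2 * t * (J + W) + S ^ 2 / (2 * (J - S))))) ≤ (1 + t) / t := by
    rw [div_mul_eq_mul_div, div_le_iff₀ (by positivity)]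
    linarith
  linarith

/-! ### Bounds in terms of `log n / √t` -/

theorem four_mul_div_le_decayRate_sq {t : ℝ} (ht : 0 < t) :
    4 * t / (1 + 2 * t) ≤ decayRate t ^ 2 := by
  rw [decayRate_sq ht]
  have h := Real.one_sub_inv_le_log_of_pos (show 0 < 1 + 2 * t by linarith)
  have e : 4 * t / (1 + 2 * t) = 2 * (1 - (1 + 2 * t)⁻¹) := by field_simp; ring
  linarith

/-- This is where the outer radius `1 / 2` comes from. -/
theorem sqrt_div_decayRate_le {t : ℝ} (ht : 0 < t) : √t / decayRate t ≤ √(1 + 2 * t) / 2 := by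
  have hl := decayRate_pos ht
  rw [div_le_iff₀ hl]
  apply Real.sqrt_le_iff.2
  refine ⟨by positivity, ?_⟩
  have h := four_mul_div_le_decayRate_sq ht
  rw [div_le_iff₀ (by linarith)] at h
  rw [mul_pow, div_pow, Real.sq_sqrt (by linarith)]
  linarith

theorem radius_le_of_mem_visited_of_inv_le {n : ℕ} (hn : 2 ≤ n) {t : ℝ} (ht : (n : ℝ)⁻¹ ≤ t)
    (ht1 : t ≤ 1) {x : Site} (hx : x ∈ visited n (1 + t)) :
    radius x ≤ (Real.log n + Real.log (8 * Real.log n)) / decayRate t := by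
  have hn2 : (2 : ℝ) ≤ n := by exact_mod_cast hn
  have hn0 : (0 : ℝ) < n := by linarith
  have ht0 : 0 < t := (inv_pos.2 hn0).trans_le ht
  have hl := decayRate_pos ht0
  have hlog : 0 < Real.log n := Real.log_pos (by linarith)
  have htl : t ≤ decayRate t := by
    have h := four_mul_div_le_decayRate_sq ht0
    rw [div_le_iff₀ (by linarith)] at h
    by_contra! hc
    nlinarith
  have hR : Real.log (n / (4 * t)) / decayRate t ≤ (n : ℝ) ^ 3 := by
    rw [div_le_iff₀ hl]
    have h1 : (n : ℝ)⁻¹ ≤ decayRate t := ht.trans htl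
    have h2 : Real.log (n / (4 * t)) ≤ n / (4 * t) := (Real.log_le_self (by positivity))
    have h3 : n / (4 * t) ≤ (n : ℝ) ^ 2 := by
      rw [div_le_iff₀ (by positivity)]
      have h4 : 1 ≤ t * n := by
        rwa [inv_le_iff_one_le_mul₀ hn0] at ht
      nlinarith
    calc _ ≤ (n : ℝ) ^ 2 := h2.trans h3
      _ = (n : ℝ) ^ 3 * (n : ℝ)⁻¹ := by field_simp
      _ ≤ _ := by gcongr
  refine (radius_le_of_mem_visited ht0 hR hx).trans ?_
  have h5 : Real.log (1 + ((n : ℝ) ^ 3 + 1) ^ 2) ≤ 8 * Real.log n := by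
    rw [show (8 : ℝ) * Real.log n = Real.log ((n : ℝ) ^ 8) by rw [Real.log_pow]; norm_num]
    apply Real.log_le_log (by positivity)
    have h6 : (2 : ℝ) ≤ (n : ℝ) ^ 3 := by nlinarith [sq_nonneg ((n : ℝ) - 1), sq_nonneg (n : ℝ)]
    have h7 : (n : ℝ) ^ 3 + 2 ≤ (n : ℝ) ^ 4 := by
      have : (n : ℝ) ^ 4 = n * (n : ℝ) ^ 3 := by ring
      nlinarith
    calc 1 + ((n : ℝ) ^ 3 + 1) ^ 2 ≤ ((n : ℝ) ^ 3 + 2) ^ 2 := by nlinarith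
      _ ≤ ((n : ℝ) ^ 4) ^ 2 := by gcongr
      _ = _ := by ring
  have h8 : 0 < Real.log (1 + ((n : ℝ) ^ 3 + 1) ^ 2) := Real.log_pos (by
    have : 0 < ((n : ℝ) ^ 3 + 1) ^ 2 := by positivity
    linarith)
  rw [Real.log_mul hn0.ne' h8.ne']
  gcongr

theorem tendsto_log_natCast : Tendsto (fun n : ℕ => Real.log n) atTop atTop :=
  Real.tendsto_log_atTop.comp tendsto_natCast_atTop_atTop

theorem tendsto_const_div_log (c : ℝ) :
    Tendsto (fun n : ℕ => c / Real.log n) atTop (𝓝 0) :=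
  tendsto_log_natCast.const_div_atTop c

/-- Hypothesis `h1` is the logarithm of the inner criterion divided by `log n`, with rounding errors
kept; `h2` places the time window beyond the radius. -/
theorem mem_visited_of_norm_scaled_le {n : ℕ} (hn : 2 ≤ n) {T σ η : ℝ} (ht : 0 < T) (hT1 : T ≤ 1)
    (hσ : 0 < σ) (hη : 0 < η) (h2 : 0 < σ - 2 * √T * (σ + √T * (Real.log n)⁻¹))
    (h1 : 0 < 1 + Real.log (η / (512 * (1 + η))) / Real.log n -
      ((1 + η) * σ + 2 * T * (2 + η) * (Real.log n)⁻¹ +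
        (σ + √T * (Real.log n)⁻¹) ^ 2 / (σ - 2 * √T * (σ + √T * (Real.log n)⁻¹))) +
        Real.log T / Real.log n)
    {x : Site} (hx : ‖scaled (Real.log n / √T) x‖ ≤ σ) : x ∈ visited n (1 + T) := by
  have hn2 : (2 : ℝ) ≤ n := by exact_mod_cast hn
  have hn0 : (0 : ℝ) < n := by linarith
  have hlog : 0 < Real.log n := Real.log_pos (by linarith)
  have hs : 0 < √T := Real.sqrt_pos.2 ht
  have hst : √T ^ 2 = T := Real.sq_sqrt ht.le
  set l := Real.log n
  set r := √T
  -- `512 = 4 · 16 · 8`, where 8 bounds `(1 + T) ^ 3`.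
  set κ := η / (512 * (1 + η)) with hκ_def
  have hκ : 0 < κ := by positivity
  rw [norm_scaled, abs_of_pos (by positivity), inv_div] at hx
  set S := σ * l / r + 1 with hS
  set a := σ * l / (2 * T) with ha
  set J := ⌈a⌉₊
  set W := ⌈η * J⌉₊
  have ha0 : 0 < a := by positivity
  have haJ : a ≤ J := Nat.le_ceil a
  have hJa : (J : ℝ) < a + 1 := Nat.ceil_lt_add_one ha0.le
  have hJ0 : (0 : ℝ) < J := ha0.trans_le haJ
  have hW1 : η * J ≤ W := Nat.le_ceil _
  have hW2 : (W : ℝ) < η * J + 1 := Nat.ceil_lt_add_one (by positivity)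
  have hS1 : S = l / r * (σ + r * l⁻¹) := by rw [hS]; field_simp
  have hJS : 2 * (a - S) = l / T * (σ - 2 * r * (σ + r * l⁻¹)) := by
    rw [hS, ha, ← hst]; field_simp
  have hJS0 : 0 < 2 * (a - S) := by rw [hJS]; positivity
  refine mem_visited_of_radius_le ht (S := S) (J := J) (W := W) (by linarith) ?_ ?_
  · have hE : 2 * T * (J + W) + S ^ 2 / (2 * (J - S)) ≤ l * ((1 + η) * σ +
        2 * T * (2 + η) * l⁻¹ + (σ + r * l⁻¹) ^ 2 / (σ - 2 * r * (σ + r * l⁻¹))) := by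
      have e1 : 2 * T * ((1 + η) * (a + 1) + 1) =
          l * ((1 + η) * σ + 2 * T * (2 + η) * l⁻¹) := by
        rw [ha]; field_simp; ring
      have e2 : S ^ 2 / (2 * (a - S)) =
          l * ((σ + r * l⁻¹) ^ 2 / (σ - 2 * r * (σ + r * l⁻¹))) := by
        rw [hJS, hS1, mul_pow, div_pow, hst]
        generalize σ - 2 * r * (σ + r * l⁻¹) = den at h2
        generalize σ + r * l⁻¹ = num
        field_simp
      rw [mul_add l, ← e1, ← e2]
      have hJW : J + W ≤ (1 + η) * (a + 1) + 1 := by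
        have := mul_le_mul_of_nonneg_left hJa.le hη.le
        linarith
      apply add_le_add
      · exact mul_le_mul_of_nonneg_left hJW (by linarith)
      · exact div_le_div_of_nonneg_left (sq_nonneg S) hJS0 (by linarith)
    have hlt : -Real.log T < l + Real.log κ - (2 * T * (J + W) + S ^ 2 / (2 * (J - S))) := by
      have h4 := mul_pos hlog h1
      have e : l * (1 + Real.log κ / l -
        ((1 + η) * σ + 2 * T * (2 + η) * l⁻¹ +
          (σ + r * l⁻¹) ^ 2 / (σ - 2 * r * (σ + r * l⁻¹))) + Real.log T / l) =
          l + Real.log κ - l * ((1 + η) * σ +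
        2 * T * (2 + η) * l⁻¹ + (σ + r * l⁻¹) ^ 2 / (σ - 2 * r * (σ + r * l⁻¹))) + Real.log T := by
        generalize (1 + η) * σ + 2 * T * (2 + η) * l⁻¹ +
          (σ + r * l⁻¹) ^ 2 / (σ - 2 * r * (σ + r * l⁻¹)) = X
        field_simp
      rw [e] at h4
      linarith
    set E := 2 * T * (J + W) + S ^ 2 / (2 * (J - S))
    have h5 : 1 / T < n * κ * Real.exp (-E) := by
      rw [← Real.log_lt_log_iff (by positivity) (by positivity), one_div, Real.log_inv,
        Real.log_mul (by positivity) (by positivity), Real.log_mul hn0.ne' hκ.ne', Real.log_exp]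
      linarith
    have hW0 : (0 : ℝ) < W := (mul_pos hη hJ0).trans_le hW1
    have h6 : η / (1 + η) ≤ W / (J + W) := by
      rw [div_le_div_iff₀ (by linarith) (by linarith)]
      linarith
    calc (1 + T) / T = (1 + T) * (1 / T) := by ring
      _ < (1 + T) * (n * κ * Real.exp (-E)) := by gcongr
      _ = (1 + T) ^ 3 * (n / (4 * (1 + T)) *
          (η / (1 + η) * (1 / (128 * (1 + T))) * Real.exp (-E))) := by
          rw [hκ_def]; field_simp; norm_num
      _ ≤ 8 * (n / (4 * (1 + T)) *
          (W / (J + W) * (1 / (128 * (1 + T))) * Real.exp (-E))) := by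
          gcongr
          have : (1 + T) ^ 3 ≤ 2 ^ 3 := by gcongr; linarith
          linarith
      _ = _ := by field_simp; norm_num
  · rw [hS, add_le_add_iff_right, le_div_iff₀ hs]
    rw [div_mul_eq_mul_div, div_le_iff₀ hlog] at hx
    linarith

/-! ### Limits: both regimes enter through `log t / log n → -(1 - α)` -/

section Asymptotics

variable {t : ℕ → ℝ} {α : ℝ}

theorem eventually_radius_le (ht_pos : ∀ n, 1 ≤ n → 0 < t n) (ht_zero : Tendsto t atTop (𝓝 0))
    (hα : 0 < α)
    (ht_log : Tendsto (fun n : ℕ => Real.log (t n) / Real.log n) atTop (𝓝 (-(1 - α))))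
    {σ : ℝ} (hσ : 1 / 2 < σ) :
    ∀ᶠ n : ℕ in atTop, ∀ x ∈ visited n (1 + t n),
      ‖scaled (Real.log n / √(t n)) x‖ ≤ σ := by
  have hlim : Tendsto (fun n : ℕ => √(1 + 2 * t n) / 2 *
      (1 + Real.log (8 * Real.log n) / (8 * Real.log n) * 8)) atTop (𝓝 (1 / 2)) := by
    have h1 : Tendsto (fun n : ℕ => √(1 + 2 * t n) / 2) atTop (𝓝 (√(1 + 2 * 0) / 2)) :=
      (((ht_zero.const_mul 2).const_add 1).sqrt).div_const 2
    have h2 : Tendsto (fun x : ℝ => Real.log x / x) atTop (𝓝 0) := by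
      simpa using Real.isLittleO_log_id_atTop.tendsto_div_nhds_zero
    have h3 := h2.comp (tendsto_log_natCast.const_mul_atTop (show (0 : ℝ) < 8 by norm_num))
    simpa using h1.mul ((h3.mul_const 8).const_add 1)
  -- Positivity of `α` gives `1 / n < t n`, which keeps the crude radius polynomial in `n`.
  have hinv : ∀ᶠ n : ℕ in atTop, -1 < Real.log (t n) / Real.log n :=
    ht_log.eventually_const_lt (by linarith)
  filter_upwards [hlim.eventually_lt_const hσ, hinv, eventually_ge_atTop 2,
    ht_zero.eventually_lt_const one_pos] with n h1 h2 hn h3 x hx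
  have ht := ht_pos n (by omega)
  have hn2 : (2 : ℝ) ≤ n := by exact_mod_cast hn
  have hlog : 0 < Real.log n := Real.log_pos (by linarith)
  have hs : 0 < √(t n) := Real.sqrt_pos.2 ht
  have hl := decayRate_pos ht
  have htn : (n : ℝ)⁻¹ ≤ t n := by
    rw [lt_div_iff₀ hlog] at h2
    rw [← Real.log_le_log_iff (by positivity) ht, Real.log_inv]
    linarith
  have h4 := radius_le_of_mem_visited_of_inv_le hn htn h3.le hx
  rw [norm_scaled, abs_of_pos (by positivity), inv_div]
  refine le_trans ?_ h1.le
  have h0 : 0 ≤ Real.log (8 * Real.log n) := by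
    apply Real.log_nonneg
    have := Real.log_le_log two_pos hn2
    have := Real.log_two_gt_d9
    linarith
  calc √(t n) / Real.log n * radius x ≤ √(t n) / Real.log n *
        ((Real.log n + Real.log (8 * Real.log n)) / decayRate (t n)) := by gcongr
    _ = √(t n) / decayRate (t n) *
      (1 + Real.log (8 * Real.log n) / (8 * Real.log n) * 8) := by field_simp
    _ ≤ _ := mul_le_mul_of_nonneg_right (sqrt_div_decayRate_le ht) (by positivity)

theorem eventually_mem_visited (ht_pos : ∀ n, 1 ≤ n → 0 < t n) (ht_zero : Tendsto t atTop (𝓝 0))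
    (ht_log : Tendsto (fun n : ℕ => Real.log (t n) / Real.log n) atTop (𝓝 (-(1 - α))))
    {σ : ℝ} (hσ0 : 0 < σ) (hσ : σ < α / 2) :
    ∀ᶠ n : ℕ in atTop, ∀ x, ‖scaled (Real.log n / √(t n)) x‖ ≤ σ → x ∈ visited n (1 + t n) := by
  -- The window costs `η σ` in the exponent; this `η` spends half of the margin `α - 2 σ`.
  set η := (α - 2 * σ) / (2 * σ) with hη_def
  have hη : 0 < η := div_pos (by linarith) (by linarith)
  have hησ : η * σ = (α - 2 * σ) / 2 := by rw [hη_def]; field_simp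
  have hsqrt : Tendsto (fun n => √(t n)) atTop (𝓝 0) := by simpa using ht_zero.sqrt
  have hinv : Tendsto (fun n : ℕ => (Real.log n)⁻¹) atTop (𝓝 0) := by
    simpa using tendsto_const_div_log 1
  have hnum : Tendsto (fun n : ℕ => σ + √(t n) * (Real.log n)⁻¹) atTop (𝓝 σ) := by
    simpa using (hsqrt.mul hinv).const_add σ
  have hden : Tendsto (fun n : ℕ => σ - 2 * √(t n) * (σ + √(t n) * (Real.log n)⁻¹))
      atTop (𝓝 σ) := by
    simpa using ((hsqrt.const_mul 2).mul hnum).const_sub σ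
  have hF : Tendsto (fun n : ℕ => 1 + Real.log (η / (512 * (1 + η))) / Real.log n -
      ((1 + η) * σ + 2 * t n * (2 + η) * (Real.log n)⁻¹ +
        (σ + √(t n) * (Real.log n)⁻¹) ^ 2 /
          (σ - 2 * √(t n) * (σ + √(t n) * (Real.log n)⁻¹))) + Real.log (t n) / Real.log n)
      atTop (𝓝 (1 + 0 - ((1 + η) * σ + 2 * 0 * (2 + η) * 0 + σ ^ 2 / σ) + -(1 - α))) :=
    ((((tendsto_const_div_log _).const_add 1).sub
      (((((ht_zero.const_mul 2).mul_const (2 + η)).mul hinv).const_add _).add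
        ((hnum.pow 2).div hden hσ0.ne'))).add ht_log)
  have hpos : 0 < 1 + 0 - ((1 + η) * σ + 2 * 0 * (2 + η) * 0 + σ ^ 2 / σ) + -(1 - α) := by
    have : σ ^ 2 / σ = σ := by field_simp
    rw [this]
    nlinarith
  filter_upwards [hF.eventually_const_lt hpos, hden.eventually_const_lt hσ0,
    eventually_ge_atTop 2, ht_zero.eventually_lt_const one_pos] with n h1 h2 hn h3 x hx
  exact mem_visited_of_norm_scaled_le hn (ht_pos n (by omega)) h3.le hσ0 hη h2 h1 hx

theorem tendsto_log_div_log_of_isLittleO (ht_pos : ∀ n, 1 ≤ n → 0 < t n)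
    (ht_zero : Tendsto t atTop (𝓝 0))
    (h : ∀ ε : ℝ, 0 < ε → (fun n : ℕ => (n : ℝ) ^ (-ε)) =o[atTop] t) :
    Tendsto (fun n : ℕ => Real.log (t n) / Real.log n) atTop (𝓝 0) := by
  refine tendsto_order.2 ⟨fun b hb => ?_, fun b hb => ?_⟩
  · filter_upwards [(h (-b / 2) (by linarith)).def one_pos, eventually_ge_atTop 2] with n h1 hn
    have ht := ht_pos n (by omega)
    have hn2 : (2 : ℝ) ≤ n := by exact_mod_cast hn
    have hn0 : (0 : ℝ) < n := by linarith
    have hlog : 0 < Real.log n := Real.log_pos (by linarith)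
    rw [one_mul, Real.norm_of_nonneg (by positivity), Real.norm_of_nonneg ht.le] at h1
    have h2 := Real.log_le_log (by positivity) h1
    rw [Real.log_rpow hn0] at h2
    rw [lt_div_iff₀ hlog]
    nlinarith
  · filter_upwards [ht_zero.eventually_lt_const one_pos, eventually_ge_atTop 2] with n h1 hn
    have ht := ht_pos n (by omega)
    have hn2 : (2 : ℝ) ≤ n := by exact_mod_cast hn
    have hlog : 0 < Real.log n := Real.log_pos (by linarith)
    exact (div_nonpos_of_nonpos_of_nonneg (Real.log_nonpos ht.le h1.le) hlog.le).trans_lt hb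

theorem tendsto_log_div_log_of_isTheta (ht_pos : ∀ n, 1 ≤ n → 0 < t n) {γ : ℝ}
    (h : t =Θ[atTop] (fun n : ℕ => (n : ℝ) ^ (-γ))) :
    Tendsto (fun n : ℕ => Real.log (t n) / Real.log n) atTop (𝓝 (-γ)) := by
  obtain ⟨c₁, hc₁, h₁⟩ := h.1.exists_pos
  obtain ⟨c₂, hc₂, h₂⟩ := h.2.exists_pos
  have l1 : Tendsto (fun n : ℕ => Real.log c₁ / Real.log n + -γ) atTop (𝓝 (-γ)) := by
    simpa using (tendsto_const_div_log (Real.log c₁)).add_const (-γ)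
  have l2 : Tendsto (fun n : ℕ => -γ - Real.log c₂ / Real.log n) atTop (𝓝 (-γ)) := by
    simpa using (tendsto_const_div_log (Real.log c₂)).const_sub (-γ)
  refine tendsto_of_tendsto_of_tendsto_of_le_of_le' l2 l1 ?_ ?_
  · filter_upwards [h₂.bound, eventually_ge_atTop 2] with n h1 hn
    have ht := ht_pos n (by omega)
    have hn2 : (2 : ℝ) ≤ n := by exact_mod_cast hn
    have hn0 : (0 : ℝ) < n := by linarith
    have hlog : 0 < Real.log n := Real.log_pos (by linarith)
    rw [Real.norm_of_nonneg (by positivity), Real.norm_of_nonneg ht.le] at h1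
    have h2 := Real.log_le_log (by positivity) h1
    rw [Real.log_rpow hn0, Real.log_mul hc₂.ne' ht.ne'] at h2
    rw [le_div_iff₀ hlog, sub_mul, div_mul_cancel₀ _ hlog.ne']
    linarith
  · filter_upwards [h₁.bound, eventually_ge_atTop 2] with n h1 hn
    have ht := ht_pos n (by omega)
    have hn2 : (2 : ℝ) ≤ n := by exact_mod_cast hn
    have hn0 : (0 : ℝ) < n := by linarith
    have hlog : 0 < Real.log n := Real.log_pos (by linarith)
    rw [Real.norm_of_nonneg (by positivity : 0 ≤ (n : ℝ) ^ (-γ)), Real.norm_of_nonneg ht.le] at h1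
    have h2 := Real.log_le_log ht h1
    rw [Real.log_mul hc₁.ne' (by positivity), Real.log_rpow hn0] at h2
    rw [div_le_iff₀ hlog, add_mul, div_mul_cancel₀ _ hlog.ne']
    linarith

end Asymptotics

/-! ### Diagonal sequences and the geometry of the boundary -/

/-- Diagonal argument: a property that holds eventually for every parameter also holds eventually
along parameters tending to infinity. -/
theorem exists_tendsto_atTop_eventually {Q : ℕ → ℕ → Prop} (h : ∀ k, ∀ᶠ n in atTop, Q n k) :
    ∃ φ : ℕ → ℕ, Tendsto φ atTop atTop ∧ ∀ᶠ n in atTop, Q n (φ n) := by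
  classical
  refine ⟨fun n => Nat.findGreatest (Q n) n, tendsto_atTop.2 fun K => ?_, ?_⟩
  · filter_upwards [h K, eventually_ge_atTop K] with n h1 h2
    exact Nat.le_findGreatest h2 h1
  -- `Nat.findGreatest` defaults to 0, so the property is needed at 0.
  · filter_upwards [h 0] with n h1
    exact Nat.findGreatest_spec (Nat.zero_le n) h1

theorem exists_tendsto_eventually {P : ℕ → ℝ → Prop} {q : ℕ → ℝ} {a : ℝ}
    (hq : Tendsto q atTop (𝓝 a)) (h : ∀ k, ∀ᶠ n in atTop, P n (q k)) :
    ∃ r : ℕ → ℝ, Tendsto r atTop (𝓝 a) ∧ ∀ᶠ n in atTop, P n (r n) := by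
  obtain ⟨φ, h1, h2⟩ := exists_tendsto_atTop_eventually (Q := fun n k => P n (q k)) h
  exact ⟨q ∘ φ, hq.comp h1, h2⟩

/-- Between a site of a set and a site outside of it there is a boundary site of the set. -/
theorem exists_mem_boundary {D : Set Site} {P Q : Site} (hP : P ∈ D) (hQ : Q ∉ D) :
    ∃ b ∈ boundary D, b.1 ∈ Set.uIcc P.1 Q.1 ∧ b.2 ∈ Set.uIcc P.2 Q.2 := by
  obtain ⟨k, hk⟩ : ∃ k, (P.1 - Q.1).natAbs + (P.2 - Q.2).natAbs = k := ⟨_, rfl⟩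
  induction k generalizing P with
  | zero =>
    have : P = Q := by ext <;> omega
    exact absurd (this ▸ hP) hQ
  | succ k ih =>
    -- A lattice path to `Q` that shortens the ℓ¹ distance stays in the box spanned by `P` and `Q`;
    -- its last site before leaving `D` is a boundary site.
    obtain ⟨P', hn, hk', h1, h2⟩ : ∃ P' ∈ neighbors P,
        (P'.1 - Q.1).natAbs + (P'.2 - Q.2).natAbs = k ∧
        P'.1 ∈ Set.uIcc P.1 Q.1 ∧ P'.2 ∈ Set.uIcc P.2 Q.2 := by
      simp only [Set.mem_uIcc]
      rcases lt_trichotomy P.1 Q.1 with h | h | h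
      · exact ⟨(P.1 + 1, P.2), by simp [neighbors], by dsimp only; omega, by dsimp only; omega,
          by dsimp only; omega⟩
      · rcases lt_or_ge P.2 Q.2 with h' | h'
        · exact ⟨(P.1, P.2 + 1), by simp [neighbors], by dsimp only; omega, by dsimp only; omega,
            by dsimp only; omega⟩
        · exact ⟨(P.1, P.2 - 1), by simp [neighbors], by dsimp only; omega, by dsimp only; omega,
            by dsimp only; omega⟩
      · exact ⟨(P.1 - 1, P.2), by simp [neighbors], by dsimp only; omega, by dsimp only; omega,
          by dsimp only; omega⟩
    by_cases hD : P' ∈ D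
    · obtain ⟨b, hb, hb1, hb2⟩ := ih hD hk'
      exact ⟨b, hb, Set.uIcc_subset_uIcc h1 Set.right_mem_uIcc hb1,
        Set.uIcc_subset_uIcc h2 Set.right_mem_uIcc hb2⟩
    · exact ⟨P, ⟨hP, P', hn, hD⟩, Set.left_mem_uIcc, Set.left_mem_uIcc⟩

theorem norm_le_of_abs_le {v : EuclideanSpace ℝ (Fin 2)} {c : ℝ} (h0 : |v 0| ≤ c)
    (h1 : |v 1| ≤ c) : ‖v‖ ≤ 2 * c := by
  have hc : 0 ≤ c := (abs_nonneg _).trans h0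
  rw [EuclideanSpace.norm_eq, Fin.sum_univ_two]
  apply Real.sqrt_le_iff.2
  refine ⟨by positivity, ?_⟩
  rw [Real.norm_eq_abs, Real.norm_eq_abs]
  have := pow_le_pow_left₀ (abs_nonneg _) h0 2
  have := pow_le_pow_left₀ (abs_nonneg _) h1 2
  nlinarith

theorem abs_apply_le (v : EuclideanSpace ℝ (Fin 2)) (i : Fin 2) : |v i| ≤ ‖v‖ :=
  PiLp.norm_apply_le v i

theorem scaled_zero (R : ℝ) (x : Site) : scaled R x 0 = R⁻¹ * x.1 := by simp [scaled]

theorem scaled_one (R : ℝ) (x : Site) : scaled R x 1 = R⁻¹ * x.2 := by simp [scaled]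

theorem abs_inv_mul_floor_sub_le {R : ℝ} (hR : 0 < R) (a : ℝ) : |R⁻¹ * ⌊R * a⌋ - a| ≤ R⁻¹ := by
  have h1 := Int.floor_le (R * a)
  have h2 := Int.lt_floor_add_one (R * a)
  have e : R⁻¹ * ⌊R * a⌋ - a = -(R⁻¹ * (R * a - ⌊R * a⌋)) := by field_simp; ring
  rw [e, abs_neg, abs_of_nonneg (by have : 0 ≤ R * a - ⌊R * a⌋ := by linarith
                                    positivity)]
  exact mul_le_of_le_one_right (by positivity) (by linarith)

/-- Every point of the plane is close to a scaled site. -/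
theorem exists_scaled_near {R : ℝ} (hR : 0 < R) (v : EuclideanSpace ℝ (Fin 2)) :
    ∃ x : Site, |scaled R x 0 - v 0| ≤ R⁻¹ ∧ |scaled R x 1 - v 1| ≤ R⁻¹ ∧
      ‖scaled R x - v‖ ≤ 2 * R⁻¹ := by
  have h0 := abs_inv_mul_floor_sub_le hR (v 0)
  have h1 := abs_inv_mul_floor_sub_le hR (v 1)
  rw [← scaled_zero R (⌊R * v 0⌋, ⌊R * v 1⌋)] at h0
  rw [← scaled_one R (⌊R * v 0⌋, ⌊R * v 1⌋)] at h1
  exact ⟨_, h0, h1, norm_le_of_abs_le h0 h1⟩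

theorem abs_sub_le_of_mem_uIcc {a b c z R s : ℝ} (hR : 0 < R) (h : c ∈ Set.uIcc a b)
    (ha : |R⁻¹ * a - z| ≤ s) (hb : |R⁻¹ * b - z| ≤ s) : |R⁻¹ * c - z| ≤ s := by
  rw [abs_le] at *
  have hR' : 0 < R⁻¹ := inv_pos.2 hR
  rcases Set.mem_uIcc.1 h with ⟨h1, h2⟩ | ⟨h1, h2⟩
  · have := mul_le_mul_of_nonneg_left h1 hR'.le
    have := mul_le_mul_of_nonneg_left h2 hR'.le
    constructor <;> linarith
  · have := mul_le_mul_of_nonneg_left h1 hR'.le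
    have := mul_le_mul_of_nonneg_left h2 hR'.le
    constructor <;> linarith

theorem cast_mem_uIcc {a b c : ℤ} (h : c ∈ Set.uIcc a b) :
    (c : ℝ) ∈ Set.uIcc (a : ℝ) (b : ℝ) := by
  rw [Set.mem_uIcc] at *
  exact_mod_cast h

/-- The boundary of a set that lies between two nearby circles is close to a circle. -/
theorem hausdorffEDist_boundary_le {D : Set Site} {R ε : ℝ} (hR : 0 < R) (hRε : R⁻¹ ≤ ε)
    (hε : ε ≤ 1 / 8) (hin : ∀ x, ‖scaled R x‖ ≤ 1 / 2 - ε → x ∈ D)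
    (hout : ∀ x ∈ D, ‖scaled R x‖ ≤ 1 / 2 + ε) :
    Metric.hausdorffEDist (scaled R '' boundary D)
      (Metric.sphere (0 : EuclideanSpace ℝ (Fin 2)) (1 / 2)) ≤ ENNReal.ofReal (10 * ε) := by
  have hε0 : 0 < ε := (inv_pos.2 hR).trans_le hRε
  refine Metric.hausdorffEDist_le_of_mem_edist ?_ ?_
  · rintro _ ⟨x, ⟨hxD, y, hy, hyD⟩, rfl⟩
    set b := scaled R x
    have h1 := hout x hxD
    have h2 : 1 / 2 - 2 * ε ≤ ‖b‖ := by
      have h3 : 1 / 2 - ε < ‖scaled R y‖ := not_le.1 fun h => hyD (hin y h)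
      have h4 := norm_scaled_sub_of_mem_neighbors (R := R) hy
      rw [abs_of_pos hR] at h4
      have h5 := norm_le_norm_add_norm_sub (scaled R x) (scaled R y)
      rw [h4] at h5
      linarith
    have hb : 0 < ‖b‖ := by linarith
    -- Radial projection onto the circle.
    refine ⟨(1 / 2 / ‖b‖) • b, ?_, ?_⟩
    · rw [mem_sphere_zero_iff_norm, norm_smul, Real.norm_of_nonneg (by positivity)]
      field_simp
    · rw [edist_dist]
      apply ENNReal.ofReal_le_ofReal
      have e : b - (1 / 2 / ‖b‖) • b = (1 - 1 / 2 / ‖b‖) • b := by rw [sub_smul, one_smul]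
      have e2 : (1 - 1 / 2 / ‖b‖) * ‖b‖ = ‖b‖ - 1 / 2 := by field_simp
      rw [dist_eq_norm, e, norm_smul, Real.norm_eq_abs, ← abs_of_pos hb, ← abs_mul,
        abs_of_pos hb, e2, abs_le]
      constructor <;> linarith
  · intro z hz
    rw [mem_sphere_zero_iff_norm] at hz
    have hz0 := abs_apply_le z 0
    have hz1 := abs_apply_le z 1
    rw [hz] at hz0 hz1
    have hnorm (c : ℝ) (hc : 0 ≤ c) : ‖c • z‖ = c / 2 := by
      rw [norm_smul, hz, Real.norm_of_nonneg hc]; ring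
    -- These points have norms `1 / 2 - 3 ε` and `1 / 2 + 4 ε`. Rounding moves them by at most `2
    -- ε`, which leaves `P` inside `D` and `Q` outside. Both are within `5 ε` of `z` in each
    -- coordinate, hence so is the boundary site in their box.
    obtain ⟨P, hP0, hP1, hP⟩ := exists_scaled_near hR ((1 - 6 * ε) • z)
    obtain ⟨Q, hQ0, hQ1, hQ⟩ := exists_scaled_near hR ((1 + 8 * ε) • z)
    have hPD : P ∈ D := hin P (by
      have := norm_le_norm_add_norm_sub' (scaled R P) ((1 - 6 * ε) • z)
      rw [hnorm _ (by linarith)] at this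
      linarith)
    have hQD : Q ∉ D := fun h => by
      have h1 := hout Q h
      have h2 := norm_le_norm_add_norm_sub (scaled R Q) ((1 + 8 * ε) • z)
      rw [hnorm _ (by linarith)] at h2
      linarith
    obtain ⟨b, hb, hb1, hb2⟩ := exists_mem_boundary hPD hQD
    have bound {c p q : ℝ} (hc : |c| ≤ 1 / 2) (hp : |p - (1 - 6 * ε) * c| ≤ R⁻¹)
        (hq : |q - (1 + 8 * ε) * c| ≤ R⁻¹) : |p - c| ≤ 5 * ε ∧ |q - c| ≤ 5 * ε := by
      rw [abs_le] at hc hp hq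
      refine ⟨abs_le.2 ⟨?_, ?_⟩, abs_le.2 ⟨?_, ?_⟩⟩ <;> nlinarith
    have k0 := bound hz0 (by simpa using hP0) (by simpa using hQ0)
    have k1 := bound hz1 (by simpa using hP1) (by simpa using hQ1)
    rw [scaled_zero, scaled_zero] at k0
    rw [scaled_one, scaled_one] at k1
    refine ⟨scaled R b, ⟨b, hb, rfl⟩, ?_⟩
    rw [edist_dist, dist_comm, dist_eq_norm]
    apply ENNReal.ofReal_le_ofReal
    have h0 := abs_sub_le_of_mem_uIcc hR (cast_mem_uIcc hb1) k0.1 k0.2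
    have h1 := abs_sub_le_of_mem_uIcc hR (cast_mem_uIcc hb2) k1.1 k1.2
    rw [← scaled_zero] at h0
    rw [← scaled_one] at h1
    have := norm_le_of_abs_le (v := scaled R b - z) h0 h1
    linarith

end LeakySandpile

theorem theorem1p2 (t : ℕ → ℝ) (ht_pos : ∀ n, 1 ≤ n → 0 < t n)
    (ht_zero : Tendsto t atTop (𝓝 0)) :
    ((∀ ε : ℝ, 0 < ε → (fun n : ℕ => (n : ℝ) ^ (-ε)) =o[atTop] t) →
      Tendsto
        (fun n : ℕ => Metric.hausdorffEDist
          (LeakySandpile.scaled (Real.log n / √(t n)) ''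
            LeakySandpile.boundary (LeakySandpile.visited n (1 + t n)))
          (Metric.sphere (0 : EuclideanSpace ℝ (Fin 2)) (1 / 2)))
        atTop (𝓝 0)) ∧
    (∀ α : ℝ, 0 < α → α < 1 → t =Θ[atTop] (fun n : ℕ => (n : ℝ) ^ (-(1 - α))) →
      ∃ rIn rOut : ℕ → ℝ,
        Tendsto rIn atTop (𝓝 (α / 2)) ∧ Tendsto rOut atTop (𝓝 (1 / 2)) ∧
        Tendsto (fun n => rIn n / rOut n) atTop (𝓝 α) ∧
        ∀ᶠ n : ℕ in atTop,
          (∀ x : LeakySandpile.Site,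
            ‖LeakySandpile.scaled (Real.log n / √(t n)) x‖ ≤ rIn n →
              x ∈ LeakySandpile.visited n (1 + t n)) ∧
          (∀ x ∈ LeakySandpile.visited n (1 + t n),
            ‖LeakySandpile.scaled (Real.log n / √(t n)) x‖ ≤ rOut n)) := by
  refine ⟨fun h => ?_, fun α hα0 _ h => ?_⟩
  -- The first regime is the case `α = 1` of both bounds, so the two radii coincide.
  · have hlog : Tendsto (fun n : ℕ => Real.log (t n) / Real.log n) atTop (𝓝 (-(1 - 1))) := by
      simpa using LeakySandpile.tendsto_log_div_log_of_isLittleO ht_pos ht_zero h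
    refine ENNReal.tendsto_nhds_zero.2 fun δ hδ => ?_
    obtain ⟨ε, hε0, hε, hεδ⟩ : ∃ ε : ℝ, 0 < ε ∧ ε ≤ 1 / 8 ∧ ENNReal.ofReal (10 * ε) ≤ δ := by
      by_cases htop : δ = ⊤
      · exact ⟨1 / 8, by norm_num, le_rfl, by simp [htop]⟩
      · have hδ' := ENNReal.toReal_pos hδ.ne' htop
        refine ⟨min (1 / 8) (δ.toReal / 10), by positivity, min_le_left _ _, ?_⟩
        apply ENNReal.ofReal_le_of_le_toReal
        linarith [min_le_right (1 / 8) (δ.toReal / 10)]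
    have hscale : Tendsto (fun n : ℕ => √(t n) / Real.log n) atTop (𝓝 0) :=
      ht_zero.sqrt.div_atTop LeakySandpile.tendsto_log_natCast
    filter_upwards [
      LeakySandpile.eventually_radius_le ht_pos ht_zero one_pos hlog
        (show 1 / 2 < 1 / 2 + ε by linarith),
      LeakySandpile.eventually_mem_visited ht_pos ht_zero hlog
        (show 0 < 1 / 2 - ε by linarith) (by linarith),
      hscale.eventually_lt_const hε0, eventually_ge_atTop 2] with n hout hin hsc hn
    have ht := ht_pos n (by omega)
    have hn2 : (2 : ℝ) ≤ n := by exact_mod_cast hn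
    have hl : 0 < Real.log n := Real.log_pos (by linarith)
    refine (LeakySandpile.hausdorffEDist_boundary_le ?_ ?_ hε hin hout).trans hεδ
    · have := Real.sqrt_pos.2 ht
      positivity
    · rw [inv_div]
      exact hsc.le
  · have hlog := LeakySandpile.tendsto_log_div_log_of_isTheta ht_pos h
    -- The factor `α / 4` keeps every inner radius positive, already at `k = 0`.
    have hin_lim : Tendsto (fun k : ℕ => α / 2 - α / 4 * (1 / ((k : ℝ) + 1))) atTop
        (𝓝 (α / 2)) := by
      simpa using (tendsto_one_div_add_atTop_nhds_zero_nat.const_mul (α / 4)).const_sub (α / 2)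
    have hout_lim : Tendsto (fun k : ℕ => 1 / 2 + 1 / ((k : ℝ) + 1)) atTop
        (𝓝 (1 / 2)) := by
      simpa using tendsto_one_div_add_atTop_nhds_zero_nat.const_add (1 / 2 : ℝ)
    obtain ⟨rIn, hrIn, hin⟩ := LeakySandpile.exists_tendsto_eventually
      (P := fun n σ => ∀ x, ‖LeakySandpile.scaled (Real.log n / √(t n)) x‖ ≤ σ →
        x ∈ LeakySandpile.visited n (1 + t n)) hin_lim fun k => by
        have h1 : 0 < 1 / ((k : ℝ) + 1) := by positivity
        have h2 : 1 / ((k : ℝ) + 1) ≤ 1 := by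
          rw [div_le_one (by positivity)]
          linarith [(Nat.cast_nonneg k : (0 : ℝ) ≤ k)]
        exact LeakySandpile.eventually_mem_visited ht_pos ht_zero hlog (by nlinarith)
          (by nlinarith)
    obtain ⟨rOut, hrOut, hout⟩ := LeakySandpile.exists_tendsto_eventually
      (P := fun n σ => ∀ x ∈ LeakySandpile.visited n (1 + t n),
        ‖LeakySandpile.scaled (Real.log n / √(t n)) x‖ ≤ σ) hout_lim fun k =>
        LeakySandpile.eventually_radius_le ht_pos ht_zero hα0 hlog (by
          have : 0 < 1 / ((k : ℝ) + 1) := by positivity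
          linarith)
    refine ⟨rIn, rOut, hrIn, hrOut, ?_, hin.and hout⟩
    have hdiv := hrIn.div hrOut (by norm_num)
    rwa [show α / 2 / (1 / 2) = α by ring] at hdiv
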